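/- Let $D\subset\mathbb{C}^2$ be a convex domain (a non-empty convex open set) containing no complex lines, i.e. there are no $a,v\in\mathbb{C}^2$, $v\neq 0$, with $a+\mathbb{C}v\subset D$. Assume that $\partial D$ is $\mathcal{C}^{1,1}$-smooth, i.e. every $p\in\partial D$ has an open neighbourhood $U$ with a differentiable function $\varrho:U\to\mathbb{R}$ such that $d\varrho$ is Lipschitz and nowhere zero on $U$ and $D\cap U=\{z\in U:\varrho(z)<0\}$. Assume also that $\partial D$ contains an analytic disc, i.e. there is a non-constant holomorphic map $\varphi:\mathbb{D}\to\mathbb{C}^2$ of the open unit disc $\mathbb{D}$ with $\varphi(\mathbb{D})\subset\partial D$. For $z,w\in D$ let $$l_D(z,w)=\inf\{\tanh^{-1}|\alpha| : \alpha\in\mathbb{D},\ \exists\,\varphi:\mathbb{D}\to D\ \text{holomorphic with}\ \varphi(0)=z,\ \varphi(\alpha)=w\},$$ and let the Kobayashi distance $k_D$ be the largest pseudodistance on $D$ not exceeding $l_D$. Then $D$ is not Gromov hyperbolic with respect to $k_D$; that is, with $(x,y)_w=k_D(x,w)+k_D(w,y)-k_D(x,y)$, $$\sup_{p,q,x,w\in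 D}\Bigl(\min\{(p,x)_w,(x,q)_w\}-(p,q)_w\Bigr)=\infty .$$ -/

import Mathlib

open Metric Set

noncomputable section

namespace KobGromov

section Boundary

variable {E : Type*} [NormedAddCommGroup E] [NormedSpace ℝ E]

/-- The boundary of `D` is `C^{1,1}`-smooth: near every boundary point, `D` is the sublevel set
`{ρ < 0}` of a differentiable function with Lipschitz and nowhere vanishing derivative. -/
def HasC11Boundary (D : Set E) : Prop :=
  ∀ p ∈ frontier D, ∃ U : Set E, IsOpen U ∧ p ∈ U ∧ ∃ (ρ : E → ℝ) (K : NNReal),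
    DifferentiableOn ℝ ρ U ∧ LipschitzOnWith K (fderiv ℝ ρ) U ∧
    (∀ x ∈ U, fderiv ℝ ρ x ≠ 0) ∧ (∀ x ∈ U, x ∈ D ↔ ρ x < 0)

end Boundary

section Complex

variable {E : Type*} [NormedAddCommGroup E] [NormedSpace ℂ E]

/-- `S` contains a complex affine line. -/
def ContainsComplexLine (S : Set E) : Prop :=
  ∃ a v : E, v ≠ 0 ∧ ∀ ζ : ℂ, a + ζ • v ∈ S

/-- `φ` is a holomorphic map from the open unit disc into `S`. -/
def IsHolomorphicDisc (S : Set E) (φ : ℂ → E) : Prop :=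
  DifferentiableOn ℂ φ (ball 0 1) ∧ MapsTo φ (ball 0 1) S

/-- `S` contains an analytic disc: the image of a non-constant holomorphic map from the open
unit disc. -/
def ContainsAnalyticDisc (S : Set E) : Prop :=
  ∃ φ : ℂ → E, IsHolomorphicDisc S φ ∧ ∃ ζ ∈ ball (0 : ℂ) 1, φ ζ ≠ φ 0

/-- The Lempert function
`l_D(z,w) = inf {artanh |α| : φ holomorphic from the unit disc to D, φ(0) = z, φ(α) = w}`. -/
def lempertFunction (D : Set E) (z w : D) : ℝ :=
  sInf {r : ℝ | ∃ φ : ℂ → E, IsHolomorphicDisc D φ ∧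
    ∃ α ∈ ball (0 : ℂ) 1, φ 0 = z ∧ φ α = w ∧ r = Real.artanh ‖α‖}

/-- Pseudodistances on a type. -/
structure IsPseudodistance {X : Type*} (d : X → X → ℝ) : Prop where
  nonneg : ∀ x y, 0 ≤ d x y
  self : ∀ x, d x x = 0
  symm : ∀ x y, d x y = d y x
  triangle : ∀ x y z, d x z ≤ d x y + d y z

/-- The Kobayashi (pseudo)distance `k_D`: the largest pseudodistance on `D` not exceeding the
Lempert function. It is the pointwise supremum of all such pseudodistances, which is again
one of them. -/
def kobayashiDist (D : Set E) (z w : D) : ℝ :=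
  sSup {r : ℝ | ∃ d : D → D → ℝ, IsPseudodistance d ∧
    (∀ x y, d x y ≤ lempertFunction D x y) ∧ r = d z w}

end Complex

section Gromov

variable {X : Type*}

/-- The Gromov product `(x,y)_z` (without the factor `1/2`). -/
def gromovProduct (d : X → X → ℝ) (x y z : X) : ℝ :=
  d x z + d z y - d x y

/-- `S_d(p,q,x,w) = min {(p,x)_w, (x,q)_w} - (p,q)_w`. -/
def gromovS (d : X → X → ℝ) (p q x w : X) : ℝ :=
  min (gromovProduct d p x w) (gromovProduct d x q w) - gromovProduct d p q w

/-- Gromov hyperbolicity: `S_d` is bounded above. -/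
def IsGromovHyperbolic (d : X → X → ℝ) : Prop :=
  ∃ C : ℝ, ∀ p q x w : X, gromovS d p q x w ≤ C

end Gromov

end KobGromov

end

/-! ### Function theory on the unit disc. -/

namespace KobGromov

/-! A supporting functional `f` at the centre of the boundary disc has minimal real part there, so
it is constant along the disc, which therefore lies in a face of `closure D`. In its complex line
that face is a convex set with interior, and it is not the whole line because `D` contains no
complex line. After rescaling it contains the closed unit disc but no real point beyond `1`
(`exists_face_disc`). The `C^{1,1}` condition attaches tangent discs of uniform radius to this face,
so `D` contains a bidisc (`HasC11Boundary.exists_tangent_disc`).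

In (transversal, tangential) coordinates take `p = (δ, 0)`, `q = (δ, 1 - h²)`, `x = (δh, 1 - h)`, `w
= (δ/h, 1 - h)`. In the bidisc the sides `px`, `xq`, `qw`, `wp` have length at most `1/2 log (1/h) +
O(1)` (`kobayashiDist_le_half_log`). Both diagonals have length at least `log (1/h) - O(1)`, by
`abs_log_re_sub_le_kobayashiDist` applied to `f` for `xw` and, for `pq`, to a functional separating
the exterior point `(δ, 1 + h²)` from `D`. Hence `gromovS` is at least `log (1/h) - O(1)`, which is
unbounded as `h → 0`. -/

/-- A holomorphic self-map of the unit disc carrying `0` and `(Λ - 1) / (Λ + 1)` to prescribed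
real points whose Poincaré distance is at most `1 / 2 * log Λ`. -/
theorem exists_mobius {a b Λ : ℝ} (ha : |a| < 1) (hb : |b| < 1) (hΛ : 1 < Λ)
    (h₁ : (1 + a) * (1 - b) ≤ Λ * ((1 - a) * (1 + b)))
    (h₂ : (1 + b) * (1 - a) ≤ Λ * ((1 - b) * (1 + a))) :
    ∃ m : ℂ → ℂ, IsHolomorphicDisc (ball 0 1) m ∧ m 0 = a ∧
      m (((Λ - 1) / (Λ + 1) : ℝ) : ℂ) = b := by
  rw [abs_lt] at ha hb
  have hab : 0 < 1 - a * b := by nlinarith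
  have ha2 : 0 < 1 - a ^ 2 := by nlinarith
  set β : ℝ := (Λ - 1) / (Λ + 1) with hβ
  have hβ0 : 0 < β := div_pos (by linarith) (by linarith)
  -- `|k|` is the pseudohyperbolic distance, and the two hypotheses amount to `|k| ≤ β`. Contracting
  -- by `k / β` before the automorphism taking `0` to `a` sends `β` to `b`. As `β` depends on `Λ`
  -- alone, two such maps can serve as coordinates of one disc.
  set k : ℝ := (b - a) / (1 - a * b) with hk
  set c : ℝ := k / β with hc
  have hkβ : |k| ≤ β := by
    rw [hk, abs_div, abs_of_pos hab, hβ, div_le_div_iff₀ hab (by linarith), ← abs_of_pos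
      (show 0 < Λ + 1 by linarith), ← abs_mul, abs_le]
    constructor <;> nlinarith
  have hc1 : |c| ≤ 1 := by
    rw [hc, abs_div, abs_of_pos hβ0]
    exact div_le_one_of_le₀ hkβ hβ0.le
  have key : ∀ ζ ∈ ball (0 : ℂ) 1, ‖(c : ℂ) * ζ + a‖ < ‖1 + (a : ℂ) * (c * ζ)‖ := by
    intro ζ hζ
    have hu : ‖(c : ℂ) * ζ‖ < 1 := by
      rw [norm_mul, Complex.norm_real, Real.norm_eq_abs]
      have := mem_ball_zero_iff.1 hζ
      nlinarith [norm_nonneg ζ, abs_nonneg c]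
    generalize (c : ℂ) * ζ = u at hu ⊢
    have hu2 : ‖u‖ ^ 2 < 1 := by nlinarith [norm_nonneg u]
    refine lt_of_pow_lt_pow_left₀ 2 (norm_nonneg _) ?_
    rw [Complex.sq_norm, Complex.normSq_apply] at hu2
    rw [Complex.sq_norm, Complex.sq_norm, Complex.normSq_apply, Complex.normSq_apply]
    simp only [Complex.add_re, Complex.add_im, Complex.ofReal_re, Complex.ofReal_im,
      Complex.mul_re, Complex.mul_im, Complex.one_re, Complex.one_im]
    -- The squared norms differ by `(1 - a²)(1 - |u|²)`.
    nlinarith [mul_pos ha2 (sub_pos.2 hu2)]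
  have hden : ∀ ζ ∈ ball (0 : ℂ) 1, 1 + (a : ℂ) * (c * ζ) ≠ 0 := fun ζ hζ =>
    norm_pos_iff.1 ((norm_nonneg _).trans_lt (key ζ hζ))
  refine ⟨fun ζ => (c * ζ + a) / (1 + a * (c * ζ)), ⟨?_, ?_⟩, by simp, ?_⟩
  · exact DifferentiableOn.div (by fun_prop) (by fun_prop) hden
  · intro ζ hζ
    rw [mem_ball_zero_iff, norm_div, div_lt_one (norm_pos_iff.2 (hden ζ hζ))]
    exact key ζ hζ
  · have hcβ : (c : ℂ) * (β : ℂ) = k := by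
      rw [← Complex.ofReal_mul, hc, div_mul_cancel₀ _ hβ0.ne']
    have hreal : (k + a) / (1 + a * k) = b := by
      have hk' : k * (1 - a * b) = b - a := div_mul_cancel₀ _ hab.ne'
      have hne : 1 + a * k ≠ 0 := by
        intro h
        have : (1 + a * k) * (1 - a * b) = 1 - a ^ 2 := by linear_combination a * hk'
        rw [h, zero_mul] at this
        linarith
      rw [div_eq_iff hne]
      linear_combination hk'
    simp only [hcβ]
    exact_mod_cast congrArg (fun x : ℝ => (x : ℂ)) hreal

theorem artanh_sub_one_div_add_one {Λ : ℝ} (hΛ : 1 < Λ) :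
    Real.artanh ((Λ - 1) / (Λ + 1)) = 1 / 2 * Real.log Λ := by
  have h : 0 < Λ + 1 := by linarith
  have h0 : 0 ≤ (Λ - 1) / (Λ + 1) := div_nonneg (by linarith) h.le
  rw [Real.artanh_eq_half_log ⟨by linarith, div_le_one_of_le₀ (by linarith) h.le⟩]
  congr 2
  field_simp
  ring

theorem ofReal_sub_one_div_add_one_mem_ball {Λ : ℝ} (hΛ : 1 < Λ) :
    (((Λ - 1) / (Λ + 1) : ℝ) : ℂ) ∈ ball (0 : ℂ) 1 := by
  have h : 0 < Λ + 1 := by linarith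
  rw [mem_ball_zero_iff, Complex.norm_real, Real.norm_eq_abs,
    abs_of_nonneg (div_nonneg (by linarith) h.le), div_lt_one h]
  linarith

/-- The Harnack inequality for the real part of a holomorphic function on the disc. -/
theorem abs_log_re_sub_log_re_le {g : ℂ → ℂ} (hg : DifferentiableOn ℂ g (ball 0 1))
    (hpos : ∀ ζ ∈ ball (0 : ℂ) 1, 0 < (g ζ).re) {α : ℂ} (hα : α ∈ ball (0 : ℂ) 1) :
    1 / 2 * |Real.log (g 0).re - Real.log (g α).re| ≤ Real.artanh ‖α‖ := by
  have h0 : (0 : ℂ) ∈ ball (0 : ℂ) 1 := by simp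
  have hg0 := hpos 0 h0
  set w₀ := g 0 with hw₀
  have hlt : ∀ w : ℂ, 0 < w.re → ‖w - w₀‖ < ‖w + starRingEnd ℂ w₀‖ := by
    intro w hw
    refine lt_of_pow_lt_pow_left₀ 2 (norm_nonneg _) ?_
    rw [Complex.sq_norm, Complex.sq_norm, Complex.normSq_apply, Complex.normSq_apply]
    simp only [Complex.add_re, Complex.add_im, Complex.sub_re, Complex.sub_im,
      Complex.conj_re, Complex.conj_im]
    nlinarith [mul_pos hw hg0]
  have hne : ∀ ζ ∈ ball (0 : ℂ) 1, g ζ + starRingEnd ℂ w₀ ≠ 0 := fun ζ hζ =>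
    norm_pos_iff.1 ((norm_nonneg _).trans_lt (hlt _ (hpos ζ hζ)))
  -- Schwarz lemma for `g` followed by the Cayley transform that takes `w₀` to `0`.
  have hS : ‖(g α - w₀) / (g α + starRingEnd ℂ w₀)‖ ≤ ‖α‖ := by
    refine Complex.norm_le_norm_of_mapsTo_ball
      (f := fun ζ => (g ζ - w₀) / (g ζ + starRingEnd ℂ w₀)) (R := 1) ?_ ?_ ?_ ?_
    · exact DifferentiableOn.div (hg.sub_const _) (hg.add_const _) hne
    · intro ζ hζ
      have := hlt _ (hpos ζ hζ)
      rw [mem_closedBall_zero_iff, norm_div]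
      exact div_le_one_of_le₀ this.le (norm_nonneg _)
    · simp [← hw₀]
    · exact mem_ball_zero_iff.1 hα
  have hx := hpos α hα
  have hα1 : ‖α‖ < 1 := mem_ball_zero_iff.1 hα
  rw [norm_div, div_le_iff₀ (norm_pos_iff.2 (hne α hα))] at hS
  generalize g α = w at hS hx
  generalize ‖α‖ = t at hS hα1
  have ht0 : 0 ≤ t := by
    by_contra! h
    have h1 := norm_nonneg (w - w₀)
    have h2 := hlt w hx
    nlinarith
  have hsq : ‖w - w₀‖ ^ 2 ≤ t ^ 2 * ‖w + starRingEnd ℂ w₀‖ ^ 2 := by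
    rw [← mul_pow]
    exact pow_le_pow_left₀ (norm_nonneg _) hS 2
  rw [Complex.sq_norm, Complex.sq_norm, Complex.normSq_apply, Complex.normSq_apply] at hsq
  simp only [Complex.add_re, Complex.add_im, Complex.sub_re, Complex.sub_im,
      Complex.conj_re, Complex.conj_im] at hsq
  -- The imaginary parts enter both sides of `hsq` through the same square, so they drop out because
  -- `t < 1`.
  have habs : |w.re - w₀.re| ≤ t * (w.re + w₀.re) := by
    apply abs_le_of_sq_le_sq _ (by positivity)
    nlinarith [mul_nonneg (show 0 ≤ 1 - t ^ 2 by nlinarith) (sq_nonneg (w.im - w₀.im))]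
  rw [abs_le] at habs
  rw [Real.artanh_eq_half_log ⟨by linarith, hα1.le⟩]
  refine mul_le_mul_of_nonneg_left ?_ (by norm_num)
  rw [abs_le, ← Real.log_div hg0.ne' hx.ne', neg_le, ← Real.log_inv, inv_div]
  constructor
  · refine Real.log_le_log (by positivity) ?_
    rw [div_le_div_iff₀ hg0 (by linarith)]
    nlinarith
  · refine Real.log_le_log (by positivity) ?_
    rw [div_le_div_iff₀ hx (by linarith)]
    nlinarith

/-! ### Upper and lower bounds for the Kobayashi distance. -/

section Distance

variable {E : Type*} [NormedAddCommGroup E] [NormedSpace ℂ E] {D : Set E}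

theorem artanh_norm_nonneg {α : ℂ} (hα : α ∈ ball (0 : ℂ) 1) : 0 ≤ Real.artanh ‖α‖ := by
  have h := abs_log_re_sub_log_re_le (g := fun _ => 1) (by fun_prop) (by simp) hα
  simpa using h

theorem lempertFunction_le_artanh {z w : D} {φ : ℂ → E} (hφ : IsHolomorphicDisc D φ) {α : ℂ}
    (hα : α ∈ ball (0 : ℂ) 1) (h0 : φ 0 = z) (h1 : φ α = w) :
    lempertFunction D z w ≤ Real.artanh ‖α‖ := by
  refine csInf_le ⟨0, ?_⟩ ⟨φ, hφ, α, hα, h0, h1, rfl⟩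
  rintro r ⟨-, -, α, hα, -, -, rfl⟩
  exact artanh_norm_nonneg hα

theorem lempertFunction_nonneg (z w : D) : 0 ≤ lempertFunction D z w := by
  refine Real.sInf_nonneg ?_
  rintro r ⟨-, -, α, hα, -, -, rfl⟩
  exact artanh_norm_nonneg hα

theorem kobayashiDist_le_lempertFunction (z w : D) :
    kobayashiDist D z w ≤ lempertFunction D z w := by
  refine Real.sSup_le ?_ (lempertFunction_nonneg z w)
  rintro r ⟨d, -, hd, rfl⟩
  exact hd z w

theorem IsPseudodistance.le_kobayashiDist {d : D → D → ℝ} (hd : IsPseudodistance d)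
    (hle : ∀ x y, d x y ≤ lempertFunction D x y) (z w : D) : d z w ≤ kobayashiDist D z w := by
  refine le_csSup ⟨lempertFunction D z w, ?_⟩ ⟨d, hd, hle, rfl⟩
  rintro r ⟨d', -, hd', rfl⟩
  exact hd' z w

/-- A thin holomorphic disc along the unit interval. -/
theorem exists_holomorphicDisc_thickening {ε : ℝ} (hε : 0 < ε) :
    ∃ φ : ℂ → ℂ, IsHolomorphicDisc (thickening ε ((fun t : ℝ => (t : ℂ)) '' Icc 0 1)) φ ∧
      ∃ α ∈ ball (0 : ℂ) 1, φ 0 = 0 ∧ φ α = 1 := by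
  set η : ℝ := min (ε / 2) (1 / 2) with hη
  have hη0 : 0 < η := by positivity
  have hηε : η ≤ ε / 2 := min_le_left _ _
  have hη1 : η ≤ 1 / 2 := min_le_right _ _
  set β : ℝ := ε / (8 * Real.pi) with hβ
  have hβ0 : 0 < β := by positivity
  have hβπ : β * Real.pi = ε / 8 := by rw [hβ]; field_simp
  have hc : 0 < 1 + 2 * η := by linarith
  -- the parameters at which the disc takes a given value in `(0, 1)`
  have hpar : ∀ A : ℝ, 0 < A → A < 1 → ∃ a : ℝ, |a| < 1 ∧
      Complex.exp (β * Complex.log ((1 + (a : ℂ)) / 2)) = A := by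
    intro A hA0 hA1
    have he0 := Real.exp_pos (Real.log A / β)
    have he1 : Real.exp (Real.log A / β) < 1 :=
      Real.exp_lt_one_iff.2 (div_neg_of_neg_of_pos (Real.log_neg hA0 hA1) hβ0)
    refine ⟨2 * Real.exp (Real.log A / β) - 1, by rw [abs_lt]; constructor <;> linarith, ?_⟩
    have h1 : ((1 + ((2 * Real.exp (Real.log A / β) - 1 : ℝ) : ℂ)) / 2)
        = (Real.exp (Real.log A / β) : ℝ) := by push_cast; ring
    rw [h1, ← Complex.ofReal_log he0.le, Real.log_exp, ← Complex.ofReal_mul,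
      mul_div_cancel₀ _ hβ0.ne', ← Complex.ofReal_exp, Real.exp_log hA0]
  obtain ⟨a, ha, hAa⟩ := hpar (η / (1 + 2 * η)) (by positivity) (by rw [div_lt_one hc]; linarith)
  obtain ⟨b, hb, hBb⟩ := hpar ((1 + η) / (1 + 2 * η)) (by positivity)
    (by rw [div_lt_one hc]; linarith)
  have ha' := abs_lt.1 ha
  have hb' := abs_lt.1 hb
  have hp1 : 0 < (1 - a) * (1 + b) := mul_pos (by linarith) (by linarith)
  have hp2 : 0 < (1 - b) * (1 + a) := mul_pos (by linarith) (by linarith)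
  obtain ⟨Λ, hΛ⟩ := exists_gt (max 1 (max ((1 + a) * (1 - b) / ((1 - a) * (1 + b)))
    ((1 + b) * (1 - a) / ((1 - b) * (1 + a)))))
  simp only [max_lt_iff, div_lt_iff₀ hp1, div_lt_iff₀ hp2] at hΛ
  obtain ⟨m, hm, hm0, hm1⟩ := exists_mobius ha hb hΛ.1 hΛ.2.1.le hΛ.2.2.le
  have hre : ∀ ζ ∈ ball (0 : ℂ) 1, 0 < ((1 + m ζ) / 2).re := by
    intro ζ hζ
    have h := (Complex.abs_re_le_norm (m ζ)).trans_lt (mem_ball_zero_iff.1 (hm.2 hζ))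
    rw [abs_lt] at h
    simp
    linarith
  -- The power `((1 + m ζ) / 2) ^ β` has values in a thin sector about `(0, 1)`; the affine stretch
  -- by `1 + 2η` makes the endpoints `0` and `1` attained.
  refine ⟨fun ζ => -η + (1 + 2 * η) * Complex.exp (β * Complex.log ((1 + m ζ) / 2)), ⟨?_, ?_⟩,
    _, ofReal_sub_one_div_add_one_mem_ball hΛ.1, ?_, ?_⟩
  · refine DifferentiableOn.const_add _ ?_
    refine DifferentiableOn.const_mul ?_ _
    refine DifferentiableOn.cexp ?_
    refine DifferentiableOn.const_mul (DifferentiableOn.clog ?_ fun ζ hζ => Or.inl (hre ζ hζ)) _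
    simpa only [div_eq_mul_inv] using (hm.1.const_add (1 : ℂ)).mul_const (2 : ℂ)⁻¹
  · intro ζ hζ
    set u := (1 + m ζ) / 2 with hu
    have hune : u ≠ 0 := by
      intro h
      have := hre ζ hζ
      rw [← hu, h] at this
      simp at this
    have hun : ‖u‖ < 1 := by
      have h1 := mem_ball_zero_iff.1 (hm.2 hζ)
      have h2 := norm_add_le 1 (m ζ)
      rw [norm_one] at h2
      rw [hu, norm_div, Complex.norm_ofNat, div_lt_one (by norm_num)]
      linarith
    set s : ℝ := Real.exp (β * Real.log ‖u‖) with hs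
    have hs0 : 0 < s := Real.exp_pos _
    have hs1 : s < 1 := Real.exp_lt_one_iff.2
      (mul_neg_of_pos_of_neg hβ0 (Real.log_neg (norm_pos_iff.2 hune) hun))
    have hψ : Complex.exp (β * Complex.log u) = s * Complex.exp ((β * u.arg : ℝ) * Complex.I) := by
      rw [hs, Complex.ofReal_exp, ← Complex.exp_add]
      congr 1
      rw [Complex.log]
      push_cast
      ring
    have hdist : ‖Complex.exp (β * Complex.log u) - s‖ ≤ ε / 8 := by
      have h1 : ‖Complex.exp (Complex.I * (β * u.arg : ℝ)) - 1‖ ≤ ‖β * u.arg‖ :=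
        Real.norm_exp_I_mul_ofReal_sub_one_le
      have h2 : ‖β * u.arg‖ ≤ ε / 8 := by
        rw [Real.norm_eq_abs, abs_mul, abs_of_pos hβ0, ← hβπ]
        exact mul_le_mul_of_nonneg_left (Complex.abs_arg_le_pi u) hβ0.le
      rw [hψ, show (s : ℂ) * Complex.exp ((β * u.arg : ℝ) * Complex.I) - s
        = s * (Complex.exp (Complex.I * (β * u.arg : ℝ)) - 1) by rw [mul_comm Complex.I]; ring,
        norm_mul, Complex.norm_real, Real.norm_eq_abs, abs_of_pos hs0]
      nlinarith [norm_nonneg (Complex.exp (Complex.I * (β * u.arg : ℝ)) - 1)]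
    -- project the centre `-η + (1 + 2η)s` to the unit interval
    obtain ⟨t, ht, hts⟩ : ∃ t ∈ Icc (0 : ℝ) 1, |(-η + (1 + 2 * η) * s) - t| ≤ η :=
      ⟨s, ⟨hs0.le, hs1.le⟩, by rw [abs_le]; constructor <;> nlinarith⟩
    refine mem_thickening_iff.2 ⟨(t : ℂ), ⟨t, ht, rfl⟩, ?_⟩
    rw [dist_eq_norm]
    have hsplit : -(η : ℂ) + (1 + 2 * η) * Complex.exp (β * Complex.log u) - t
        = ((-η + (1 + 2 * η) * s - t : ℝ) : ℂ)
          + ((1 + 2 * η : ℝ) : ℂ) * (Complex.exp (β * Complex.log u) - s) := by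
      push_cast; ring
    rw [hsplit]
    refine (norm_add_le _ _).trans_lt ?_
    rw [norm_mul, Complex.norm_real, Complex.norm_real, Real.norm_eq_abs, Real.norm_eq_abs,
      abs_of_pos hc]
    nlinarith [norm_nonneg (Complex.exp (β * Complex.log u) - s)]
  · simp only [hm0, hAa]
    rw [← sub_eq_zero]
    norm_cast
    field_simp
    simp
  · simp only [hm1, hBb]
    rw [← sub_eq_zero]
    norm_cast
    field_simp
    ring_nf

/-- In a convex open set any two points lie on a holomorphic disc. -/
theorem exists_holomorphicDisc (hD : IsOpen D) (hc : Convex ℝ D) (z w : D) :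
    ∃ φ : ℂ → E, IsHolomorphicDisc D φ ∧ ∃ α ∈ ball (0 : ℂ) 1, φ 0 = z ∧ φ α = w := by
  have hcont : Continuous fun ζ : ℂ => (z : E) + ζ • ((w : E) - z) := by fun_prop
  have hK : IsCompact ((fun t : ℝ => (t : ℂ)) '' Icc 0 1) :=
    isCompact_Icc.image Complex.continuous_ofReal
  obtain ⟨ε, hε, hsub⟩ := hK.exists_thickening_subset_open (hD.preimage hcont) (by
    rintro _ ⟨t, ht, rfl⟩
    have := hc.add_smul_sub_mem z.2 w.2 ht
    simpa using this)
  obtain ⟨φ, hφ, α, hα, h0, h1⟩ := exists_holomorphicDisc_thickening hε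
  refine ⟨fun ζ => (z : E) + φ ζ • ((w : E) - z), ⟨?_, fun ζ hζ => hsub (hφ.2 hζ)⟩,
    α, hα, by simp [h0], by simp [h1]⟩
  exact (hφ.1.smul_const _).const_add _

/-- A holomorphic function with positive real part bounds the Kobayashi distance from below. -/
theorem abs_log_re_sub_le_kobayashiDist (hD : IsOpen D) (hc : Convex ℝ D) {g : E → ℂ}
    (hg : DifferentiableOn ℂ g D) (hpos : ∀ z ∈ D, 0 < (g z).re) (z w : D) :
    1 / 2 * |Real.log (g z).re - Real.log (g w).re| ≤ kobayashiDist D z w := by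
  refine IsPseudodistance.le_kobayashiDist
    (d := fun z w : D => 1 / 2 * |Real.log (g z).re - Real.log (g w).re|)
    ⟨fun _ _ => by positivity, fun _ => by simp, fun _ _ => by rw [abs_sub_comm],
      fun x y z => ?_⟩ (fun x y => ?_) z w
  · have := abs_sub_le (Real.log (g x).re) (Real.log (g y).re) (Real.log (g z).re)
    linarith
  -- Some disc through both points must exist: otherwise the infimum would be over the empty set and
  -- equal `0`.
  · obtain ⟨φ, hφ, α, hα, h0, h1⟩ := exists_holomorphicDisc hD hc x y
    refine le_csInf ⟨_, φ, hφ, α, hα, h0, h1, rfl⟩ ?_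
    rintro r ⟨φ, hφ, α, hα, h0, h1, rfl⟩
    have := abs_log_re_sub_log_re_le (g := g ∘ φ) (hg.comp hφ.1 hφ.2)
      (fun ζ hζ => hpos _ (hφ.2 hζ)) hα
    simpa [h0, h1] using this

end Distance

/-! ### The four-point configuration. -/

section Core

variable {E : Type*} [NormedAddCommGroup E] [NormedSpace ℂ E] {D : Set E}

/-- In each difference of Gromov products one distance to `w` cancels, leaving two diagonals minus
two sides. No symmetry of `d` is used, hence both orders of `w`, `x`. -/
theorem gromovS_ge {X : Type*} {d : X → X → ℝ} {p q x w : X} {A B C : ℝ}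
    (hpq : A ≤ d p q) (hwx : B ≤ d w x) (hxw : B ≤ d x w)
    (hpx : d p x ≤ C) (hwq : d w q ≤ C) (hxq : d x q ≤ C) (hpw : d p w ≤ C) :
    A + B - 2 * C ≤ gromovS d p q x w := by
  unfold gromovS gromovProduct
  rw [le_sub_iff_add_le, le_min_iff]
  constructor <;> linarith

/-- The Kobayashi distance in a product of two discs contained in `D`, for points with real
coordinates. -/
theorem kobayashiDist_le_half_log {o n e : E} {r : ℝ} (hr : 0 < r)
    (hsub : ∀ z₁ ∈ ball (r : ℂ) r, ∀ z₂ ∈ ball (0 : ℂ) 1, o + z₁ • n + z₂ • e ∈ D)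
    {z w : D} {δ δ' t t' Λ : ℝ} (hΛ : 1 < Λ) (hδ : δ ∈ Ioc 0 r) (hδ' : δ' ∈ Ioc 0 r)
    (ht : t ∈ Ico (0 : ℝ) 1) (ht' : t' ∈ Ico (0 : ℝ) 1)
    (hz : (z : E) = o + (δ : ℂ) • n + (t : ℂ) • e)
    (hw : (w : E) = o + (δ' : ℂ) • n + (t' : ℂ) • e)
    (h₁ : 2 * δ ≤ Λ * δ') (h₂ : 2 * δ' ≤ Λ * δ)
    (h₃ : (1 + t) * (1 - t') ≤ Λ * ((1 - t) * (1 + t')))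
    (h₄ : (1 + t') * (1 - t) ≤ Λ * ((1 - t') * (1 + t))) :
    kobayashiDist D z w ≤ 1 / 2 * Real.log Λ := by
  -- In the unit-disc coordinate `x / r - 1`, the factors `2 - x / r` and `2 - y / r` lie in `[1,
  -- 2]`; this costs the factor `2`.
  have hratio : ∀ {x y : ℝ}, x ∈ Ioc 0 r → y ∈ Ioc 0 r → 2 * x ≤ Λ * y →
      (1 + (x / r - 1)) * (1 - (y / r - 1)) ≤ Λ * ((1 - (x / r - 1)) * (1 + (y / r - 1))) := by
    intro x y hx hy h
    have hx0 : 0 < x / r := div_pos hx.1 hr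
    have hy0 : 0 < y / r := div_pos hy.1 hr
    have hx1 : x / r ≤ 1 := div_le_one_of_le₀ hx.2 hr.le
    have h' : 2 * (x / r) ≤ Λ * (y / r) := by
      rw [← mul_div_assoc, ← mul_div_assoc]
      exact div_le_div_of_nonneg_right h hr.le
    have h1 : (x / r) * (2 - y / r) ≤ 2 * (x / r) := by nlinarith
    have h2 : 0 ≤ Λ * (y / r) * (1 - x / r) :=
      mul_nonneg (mul_nonneg (by linarith) hy0.le) (by linarith)
    nlinarith
  have habs : ∀ {x : ℝ}, x ∈ Ioc 0 r → |x / r - 1| < 1 := by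
    intro x hx
    have hx0 : 0 < x / r := div_pos hx.1 hr
    have hx1 : x / r ≤ 1 := div_le_one_of_le₀ hx.2 hr.le
    rw [abs_lt]
    constructor <;> linarith
  obtain ⟨m₁, hm₁, h10, h11⟩ := exists_mobius (habs hδ) (habs hδ') hΛ
    (hratio hδ hδ' h₁) (hratio hδ' hδ h₂)
  obtain ⟨m₂, hm₂, h20, h21⟩ := exists_mobius (a := t) (b := t')
    (by rw [abs_lt]; exact ⟨by linarith [ht.1], ht.2⟩)
    (by rw [abs_lt]; exact ⟨by linarith [ht'.1], ht'.2⟩) hΛ h₃ h₄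
  have hr' : (r : ℂ) ≠ 0 := by exact_mod_cast hr.ne'
  have hcoord : ∀ x : ℝ, (r : ℂ) + r * ((x / r - 1 : ℝ) : ℂ) = x := by
    intro x
    push_cast
    field_simp
    ring
  have hα := ofReal_sub_one_div_add_one_mem_ball hΛ
  have hle := lempertFunction_le_artanh (z := z) (w := w)
    (φ := fun ζ => o + ((r : ℂ) + r * m₁ ζ) • n + m₂ ζ • e) ⟨?_, ?_⟩ hα
    (by simp only [h10, h20, hcoord, hz]) (by simp only [h11, h21, hcoord, hw])
  · rw [Complex.norm_real, Real.norm_eq_abs,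
      abs_of_nonneg (div_nonneg (by linarith) (by linarith)), artanh_sub_one_div_add_one hΛ] at hle
    exact (kobayashiDist_le_lempertFunction z w).trans hle
  · exact ((((hm₁.1.const_mul _).const_add _).smul_const n).const_add o).add (hm₂.1.smul_const e)
  · intro ζ hζ
    refine hsub _ ?_ _ (hm₂.2 hζ)
    have := mem_ball_zero_iff.1 (hm₁.2 hζ)
    rw [mem_ball, dist_eq_norm, add_sub_cancel_left, norm_mul, Complex.norm_real,
      Real.norm_eq_abs, abs_of_pos hr]
    nlinarith

/-- A convex domain containing a bidisc tangent along a face to a supporting complex hyperplane,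
and touching the relative boundary of that face, is not Gromov hyperbolic. -/
theorem not_isGromovHyperbolic_of_tangent_bidisc (hD : IsOpen D) (hc : Convex ℝ D)
    {o n e : E} (f : E →L[ℂ] ℂ) (hfn : f n = 1) (hfe : f e = 0)
    (hpos : ∀ z ∈ D, (f o).re < (f z).re) {r : ℝ} (hr : 0 < r)
    (hsub : ∀ z₁ ∈ ball (r : ℂ) r, ∀ z₂ ∈ ball (0 : ℂ) 1, o + z₁ • n + z₂ • e ∈ D)
    (hout : ∀ η : ℝ, 0 < η → o + ((1 + η : ℝ) : ℂ) • e ∉ closure D) :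
    ¬ IsGromovHyperbolic (kobayashiDist D) := by
  rintro ⟨C, hC⟩
  -- Of `3/2 log 2`, the sides `1/2 log (2/h)` contribute `log 2` and the diagonal `pq` contributes
  -- `1/2 log 2`.
  obtain ⟨h, hh0, hh1, hhC⟩ : ∃ h : ℝ, 0 < h ∧ h < 1 ∧ C + 3 / 2 * Real.log 2 < - Real.log h := by
    refine ⟨Real.exp (-(|C + 3 / 2 * Real.log 2| + 1)), Real.exp_pos _, ?_, ?_⟩
    · rw [Real.exp_lt_one_iff]
      linarith [abs_nonneg (C + 3 / 2 * Real.log 2)]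
    · rw [Real.log_exp]
      linarith [le_abs_self (C + 3 / 2 * Real.log 2)]
  -- a level at which the point `1 + h ^ 2` of the complex tangent direction lies outside `D`
  obtain ⟨δ, hδ0, hδr, hδD⟩ : ∃ δ : ℝ, 0 < δ ∧ δ < r * h ∧
      o + (δ : ℂ) • n + ((1 + h ^ 2 : ℝ) : ℂ) • e ∉ D := by
    have hcont : Continuous fun δ : ℝ => o + (δ : ℂ) • n + ((1 + h ^ 2 : ℝ) : ℂ) • e := by fun_prop
    have hopen := (isClosed_closure (s := D)).isOpen_compl.preimage hcont
    obtain ⟨ε, hε, hball⟩ := Metric.isOpen_iff.1 hopen 0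
      (by simpa [-Complex.ofReal_pow] using hout (h ^ 2) (by positivity))
    have hm : 0 < min ε (r * h) := by positivity
    refine ⟨min ε (r * h) / 2, by positivity, ?_, fun hmem => ?_⟩
    · linarith [min_le_right ε (r * h)]
    · refine hball (a := min ε (r * h) / 2) ?_ (subset_closure hmem)
      rw [mem_ball_zero_iff, Real.norm_eq_abs, abs_of_pos (by positivity)]
      linarith [min_le_left ε (r * h)]
  have hδr' : δ ∈ Ioc 0 r := ⟨hδ0, by nlinarith⟩
  have hδw : δ / h ∈ Ioc 0 r := ⟨by positivity, by rw [div_le_iff₀ hh0]; exact hδr.le⟩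
  have hδx : δ * h ∈ Ioc 0 r := ⟨by positivity, by nlinarith [hδr'.2]⟩
  have hmem : ∀ {x t : ℝ}, x ∈ Ioc 0 r → t ∈ Ico (0 : ℝ) 1 →
      o + (x : ℂ) • n + (t : ℂ) • e ∈ D := by
    intro x t hx ht
    refine hsub _ ?_ _ ?_
    · rw [mem_ball, dist_eq_norm, ← Complex.ofReal_sub, Complex.norm_real, Real.norm_eq_abs, abs_lt]
      constructor <;> linarith [hx.1, hx.2]
    · rw [mem_ball_zero_iff, Complex.norm_real, Real.norm_eq_abs, abs_of_nonneg ht.1]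
      exact ht.2
  have ht0 : (0 : ℝ) ∈ Ico (0 : ℝ) 1 := by simp
  have htq : 1 - h ^ 2 ∈ Ico (0 : ℝ) 1 := ⟨by nlinarith, by nlinarith⟩
  have htw : 1 - h ∈ Ico (0 : ℝ) 1 := ⟨by linarith, by linarith⟩
  -- Up to bounded error, `1 - h` is the Poincaré midpoint of `0` and `1 - h²`, and `δ` is the
  -- logarithmic midpoint of `δh` and `δ/h`.
  set p : D := ⟨_, hmem hδr' ht0⟩ with hp
  set q : D := ⟨_, hmem hδr' htq⟩ with hq
  set w : D := ⟨_, hmem hδw htw⟩ with hw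
  set x : D := ⟨_, hmem hδx htw⟩ with hx
  have hΛ : 1 < 2 / h := by rw [lt_div_iff₀ hh0]; linarith
  have a1 : 2 * δ ≤ 2 / h * (δ * h) := by apply le_of_eq; field_simp
  have a2 : 2 * (δ * h) ≤ 2 / h * δ := by
    rw [div_mul_eq_mul_div, le_div_iff₀ hh0]
    nlinarith [mul_pos hδ0 hh0]
  have a3 : 2 * (δ / h) ≤ 2 / h * δ := by apply le_of_eq; field_simp
  have a4 : 2 * δ ≤ 2 / h * (δ / h) := by
    rw [div_mul_div_comm, le_div_iff₀ (by positivity)]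
    nlinarith [mul_pos hδ0 hh0]
  have b1 : (1 + 0) * (1 - (1 - h)) ≤ 2 / h * ((1 - 0) * (1 + (1 - h))) := by
    rw [div_mul_eq_mul_div, le_div_iff₀ hh0]
    nlinarith
  have b2 : (1 + (1 - h)) * (1 - 0) ≤ 2 / h * ((1 - (1 - h)) * (1 + 0)) := by
    rw [div_mul_eq_mul_div, le_div_iff₀ hh0]
    nlinarith
  have b3 : (1 + (1 - h ^ 2)) * (1 - (1 - h)) ≤
      2 / h * ((1 - (1 - h ^ 2)) * (1 + (1 - h))) := by
    rw [div_mul_eq_mul_div, le_div_iff₀ hh0]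
    nlinarith [mul_pos (pow_pos hh0 2) (sub_pos.2 hh1), pow_pos hh0 4]
  have b4 : (1 + (1 - h)) * (1 - (1 - h ^ 2)) ≤
      2 / h * ((1 - (1 - h)) * (1 + (1 - h ^ 2))) := by
    rw [div_mul_eq_mul_div, le_div_iff₀ hh0]
    have h2 : h ^ 2 < 1 := by nlinarith
    have h3 : h * h ^ 2 < h := by nlinarith
    nlinarith
  have upx := kobayashiDist_le_half_log hr hsub hΛ hδr' hδx ht0 htw
    (z := p) (w := x) rfl rfl a1 a2 b1 b2
  have upw := kobayashiDist_le_half_log hr hsub hΛ hδr' hδw ht0 htw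
    (z := p) (w := w) rfl rfl a4 a3 b1 b2
  have uxq := kobayashiDist_le_half_log hr hsub hΛ hδx hδr' htw htq
    (z := x) (w := q) rfl rfl a2 a1 b4 b3
  have uwq := kobayashiDist_le_half_log hr hsub hΛ hδw hδr' htw htq
    (z := w) (w := q) rfl rfl a3 a4 b4 b3
  have hfdiff : DifferentiableOn ℂ (fun z => f z - f o) D := by fun_prop
  have hfpos : ∀ z ∈ D, 0 < (f z - f o).re := fun z hz => by
    rw [Complex.sub_re]; linarith [hpos z hz]
  have lval : ∀ x t : ℝ, (f (o + (x : ℂ) • n + (t : ℂ) • e) - f o).re = x := by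
    intro x t
    simp [hfn, hfe]
  have llog : Real.log (δ / h) - Real.log (δ * h) = - 2 * Real.log h := by
    rw [Real.log_div hδ0.ne' hh0.ne', Real.log_mul hδ0.ne' hh0.ne']
    ring
  have lwx := abs_log_re_sub_le_kobayashiDist hD hc hfdiff hfpos w x
  have lxw := abs_log_re_sub_le_kobayashiDist hD hc hfdiff hfpos x w
  rw [abs_sub_comm] at lxw
  simp only [hw, hx, lval, llog] at lwx lxw
  -- the functional separating the exterior point from `D`
  obtain ⟨g, hg⟩ := RCLike.geometric_hahn_banach_open_point (𝕜 := ℂ) hc hD hδD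
  set y := o + (δ : ℂ) • n + ((1 + h ^ 2 : ℝ) : ℂ) • e with hy
  have hgdiff : DifferentiableOn ℂ (fun z => g y - g z) D := by fun_prop
  have hgpos : ∀ z ∈ D, 0 < (g y - g z).re := fun z hz => by
    rw [Complex.sub_re]; exact sub_pos.2 (hg z hz)
  have gval : ∀ t : ℝ, (g y - g (o + (δ : ℂ) • n + (t : ℂ) • e)).re
      = (1 + h ^ 2 - t) * (g e).re := by
    intro t
    rw [← map_sub, show y - (o + (δ : ℂ) • n + (t : ℂ) • e) = ((1 + h ^ 2 - t : ℝ) : ℂ) • e by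
      rw [hy, add_sub_add_left_eq_sub, ← sub_smul, ← Complex.ofReal_sub], map_smul, smul_eq_mul,
      Complex.re_ofReal_mul]
  have hge : 0 < (g e).re := by
    have := hgpos p p.2
    simp only [hp, gval] at this
    nlinarith [sq_nonneg h]
  have lpq := abs_log_re_sub_le_kobayashiDist hD hc hgdiff hgpos p q
  -- The gaps to the exterior point are `1 + h²` from `p` and `2h²` from `q`; the common factor `(g
  -- e).re` cancels.
  have glog : -2 * Real.log h - Real.log 2 ≤
      Real.log ((1 + h ^ 2 - 0) * (g e).re) - Real.log ((1 + h ^ 2 - (1 - h ^ 2)) * (g e).re) := by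
    rw [show 1 + h ^ 2 - (1 - h ^ 2) = 2 * h ^ 2 by ring, sub_zero,
      Real.log_mul (by positivity) hge.ne', Real.log_mul (by positivity) hge.ne',
      Real.log_mul (by norm_num) (by positivity), Real.log_pow]
    have : 0 ≤ Real.log (1 + h ^ 2) := Real.log_nonneg (by nlinarith)
    push_cast
    linarith
  simp only [hp, hq, gval] at lpq
  have key := gromovS_ge (A := 1 / 2 * (-2 * Real.log h - Real.log 2))
    (B := 1 / 2 * (-2 * Real.log h))
    ((mul_le_mul_of_nonneg_left (glog.trans (le_abs_self _)) (by norm_num)).trans lpq)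
    ((mul_le_mul_of_nonneg_left (le_abs_self _) (by norm_num)).trans lwx)
    ((mul_le_mul_of_nonneg_left (le_abs_self _) (by norm_num)).trans lxw)
    upx uwq uxq upw
  rw [Real.log_div (by norm_num) hh0.ne'] at key
  have := hC p q x w
  linarith

end Core

/-! ### Interior tangent discs from `C^{1,1}` smoothness. -/

section TangentDisc

variable {E : Type*} [NormedAddCommGroup E] [NormedSpace ℂ E] {D : Set E}

/-- At the boundary points on a supporting complex hyperplane, a set with `C^{1,1}` boundary
contains tangent discs transversal to the hyperplane, of locally uniform size. -/
theorem HasC11Boundary.exists_tangent_disc_near (hD : IsOpen D) (hs : HasC11Boundary D)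
    (f : E →L[ℂ] ℂ) {c : ℝ} (hpos : ∀ z ∈ D, c < (f z).re) {n : E} (hfn : f n = 1)
    {p : E} (hp : p ∈ frontier D) (hpc : (f p).re = c) :
    ∃ ε > (0 : ℝ), ∃ r > (0 : ℝ), ∀ p' ∈ frontier D, (f p').re = c → p' ∈ ball p ε →
      ∀ z ∈ ball (r : ℂ) r, p' + z • n ∈ D := by
  obtain ⟨U, hU, hpU, ρ, K, hρ, hK, hne, hmem⟩ := hs p hp
  obtain ⟨R, hR, hRU⟩ := Metric.isOpen_iff.1 hU p hpU
  have hdiff : ∀ x ∈ U, DifferentiableAt ℝ ρ x := fun x hx => hρ.differentiableAt (hU.mem_nhds hx)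
  -- boundary values and derivatives
  have hzero : ∀ q ∈ frontier D, q ∈ U → ρ q = 0 := by
    intro q hq hqU
    rw [hD.frontier_eq] at hq
    refine le_antisymm ?_ (not_lt.1 fun h => hq.2 ((hmem q hqU).2 h))
    by_contra! hlt
    have hev : ∀ᶠ x in nhds q, 0 < ρ x ∧ x ∈ U :=
      ((hdiff q hqU).continuousAt.eventually (lt_mem_nhds hlt)).and (hU.mem_nhds hqU)
    obtain ⟨x, hxD, hx0, hxU⟩ := ((mem_closure_iff_frequently.1 hq.1).and_eventually hev).exists
    exact absurd ((hmem x hxU).1 hxD) hx0.not_gt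
  -- From `q`, moving without increasing `Re f` never enters `D`, so `ρ` stays nonnegative.
  have hderiv : ∀ q ∈ frontier D, (f q).re = c → q ∈ U → ∀ v : E, (f v).re ≤ 0 →
      0 ≤ fderiv ℝ ρ q v := by
    intro q hq hqc hqU v hv
    have hlim := ((hdiff q hqU).hasFDerivAt.hasLineDerivAt v).tendsto_slope_zero_right
    have hcont : Continuous fun t : ℝ => q + t • v := by fun_prop
    have hev : ∀ᶠ t in nhdsWithin (0 : ℝ) (Ioi 0), q + t • v ∈ U :=
      (hcont.continuousAt.eventually_mem (by simpa using hU.mem_nhds hqU)).filter_mono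
        nhdsWithin_le_nhds
    refine ge_of_tendsto hlim ?_
    filter_upwards [hev, self_mem_nhdsWithin] with t htU ht
    have ht0 : 0 < t := ht
    rw [hzero q hq hqU, sub_zero]
    refine smul_nonneg (inv_nonneg.2 ht0.le) (not_lt.1 fun hlt => ?_)
    have := hpos _ ((hmem _ htU).2 hlt)
    rw [← Complex.coe_smul, map_add, map_smul, smul_eq_mul, Complex.add_re, Complex.re_ofReal_mul,
      hqc] at this
    nlinarith
  -- Applying `hderiv` to both signs shows that the derivative of `ρ` vanishes on the kernel of `Re
  -- f`.
  have hform : ∀ q ∈ frontier D, (f q).re = c → q ∈ U → ∀ v : E,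
      fderiv ℝ ρ q v = (f v).re * fderiv ℝ ρ q n := by
    intro q hq hqc hqU v
    have hre : (f (v - (f v).re • n)).re = 0 := by
      rw [← Complex.coe_smul, map_sub, map_smul, hfn]
      simp
    have h1 := hderiv q hq hqc hqU (v - (f v).re • n) hre.le
    have h2 := hderiv q hq hqc hqU (-(v - (f v).re • n)) (by rw [map_neg, Complex.neg_re, hre]; simp)
    rw [map_neg] at h2
    rw [map_sub, map_smul, smul_eq_mul] at h1 h2
    linarith
  have hneg : fderiv ℝ ρ p n < 0 := by
    refine lt_of_le_of_ne ?_ fun h => hne p hpU ?_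
    · have := hderiv p hp hpc hpU (-n) (by rw [map_neg, hfn]; simp)
      rw [map_neg] at this
      linarith
    · ext v
      rw [hform p hp hpc hpU v, h]
      simp
  set μ := - fderiv ℝ ρ p n with hμ
  have hμ0 : 0 < μ := by linarith
  set N := ‖n‖ with hN
  have hN0 : 0 ≤ N := norm_nonneg n
  have hK0 : (0 : ℝ) ≤ K := K.2
  -- The first radius keeps the derivative along `n` at most `-μ/2` at nearby base points. On `ball
  -- r r` one has `|z|² < 2r Re z`, so the second makes the quadratic error `K N² |z|²` at most
  -- `(μ/4) Re z`, less than the linear gain.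
  refine ⟨min (R / 2) (μ / (2 * (K * N + 1))), by positivity,
    min (R / (4 * (N + 1))) (μ / (8 * (K * N ^ 2 + 1))), by positivity, ?_⟩
  intro q hq hqc hqball z hz
  set r := min (R / (4 * (N + 1))) (μ / (8 * (K * N ^ 2 + 1))) with hr
  have hr0 : 0 < r := by positivity
  have hrR : r * (4 * (N + 1)) ≤ R := (le_div_iff₀ (by positivity)).1 (min_le_left _ _)
  have hrμ : r * (8 * (K * N ^ 2 + 1)) ≤ μ := (le_div_iff₀ (by positivity)).1 (min_le_right _ _)
  rw [mem_ball, lt_min_iff, dist_eq_norm, lt_div_iff₀ (c := 2 * (K * N + 1)) (by positivity)] at hqball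
  obtain ⟨hqR, hqμ⟩ := hqball
  have hqpR : q ∈ ball p R := by rw [mem_ball, dist_eq_norm]; linarith
  have hqU : q ∈ U := hRU hqpR
  have hz2 : ‖z‖ ^ 2 < 2 * r * z.re := by
    rw [mem_ball, dist_eq_norm] at hz
    have h2 : ‖z - r‖ ^ 2 < r ^ 2 := pow_lt_pow_left₀ hz (norm_nonneg _) (by norm_num)
    rw [Complex.sq_norm, Complex.normSq_apply] at h2 ⊢
    simp only [Complex.sub_re, Complex.sub_im, Complex.ofReal_re, Complex.ofReal_im] at h2
    nlinarith
  have hzre : 0 < z.re := by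
    by_contra! h
    nlinarith [sq_nonneg ‖z‖]
  have hznorm : ‖z‖ < 2 * r := by
    by_contra! h
    nlinarith [Complex.re_le_norm z]
  have hvnorm : ‖z • n‖ = ‖z‖ * N := norm_smul z n
  have hvpR : q + z • n ∈ ball p R := by
    rw [mem_ball, dist_eq_norm, add_sub_right_comm]
    refine (norm_add_le _ _).trans_lt ?_
    rw [hvnorm]
    nlinarith
  rw [hmem _ (hRU hvpR)]
  have hmv := ((convex_ball p R).inter
    (convex_closedBall q ‖z • n‖)).norm_image_sub_le_of_norm_fderiv_le'
    (f := ρ) (𝕜 := ℝ) (φ := fderiv ℝ ρ q) (C := K * ‖z • n‖) (x := q) (y := q + z • n)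
    (fun x hx => hdiff x (hRU hx.1)) (fun x hx => ?_) ⟨hqpR, by simp⟩ ⟨hvpR, by simp⟩
  · rw [add_sub_cancel_left, hzero q hq hqU, sub_zero, hform q hq hqc hqU, map_smul, hfn,
      smul_eq_mul, mul_one, Real.norm_eq_abs, hvnorm] at hmv
    have hqn : fderiv ℝ ρ q n ≤ - μ / 2 := by
      have h1 : ‖fderiv ℝ ρ q - fderiv ℝ ρ p‖ ≤ K * ‖q - p‖ := hK.norm_sub_le hqU hpU
      have h2 := (fderiv ℝ ρ q - fderiv ℝ ρ p).le_opNorm n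
      rw [sub_apply, Real.norm_eq_abs] at h2
      have h3 := (le_abs_self _).trans h2
      have h4 : ‖fderiv ℝ ρ q - fderiv ℝ ρ p‖ * N ≤ K * ‖q - p‖ * N :=
        mul_le_mul_of_nonneg_right h1 hN0
      nlinarith [norm_nonneg (q - p)]
    have h5 := (le_abs_self _).trans hmv
    have h6 : K * N ^ 2 * ‖z‖ ^ 2 ≤ K * N ^ 2 * (2 * r * z.re) :=
      mul_le_mul_of_nonneg_left hz2.le (by positivity)
    have h7 : z.re * fderiv ℝ ρ q n ≤ z.re * (- μ / 2) := mul_le_mul_of_nonneg_left hqn hzre.le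
    have h8 : z.re * (r * (8 * (K * N ^ 2 + 1))) ≤ z.re * μ := mul_le_mul_of_nonneg_left hrμ hzre.le
    nlinarith [mul_pos hzre hμ0, mul_pos hzre hr0]
  · refine (hK.norm_sub_le (hRU hx.1) hqU).trans (mul_le_mul_of_nonneg_left ?_ hK0)
    simpa [dist_eq_norm] using hx.2

end TangentDisc

/-! ### The boundary face and the conclusion. -/

section Face

variable {E : Type*} [NormedAddCommGroup E] [NormedSpace ℂ E] {D : Set E}

theorem ball_ofReal_subset_ball_ofReal {r r' : ℝ} (h : r' ≤ r) :
    ball (r' : ℂ) r' ⊆ ball (r : ℂ) r := by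
  refine ball_subset_ball' ?_
  rw [dist_eq_norm, ← Complex.ofReal_sub, Complex.norm_real, Real.norm_eq_abs,
    abs_of_nonpos (by linarith)]
  linarith

/-- Compactness makes the local radii uniform, since tangent discs shrink with their radius. -/
theorem HasC11Boundary.exists_tangent_disc (hD : IsOpen D) (hs : HasC11Boundary D)
    (f : E →L[ℂ] ℂ) {c : ℝ} (hpos : ∀ z ∈ D, c < (f z).re) {n : E} (hfn : f n = 1)
    {S : Set E} (hS : IsCompact S) (hSD : S ⊆ frontier D) (hSc : ∀ p ∈ S, (f p).re = c) :
    ∃ r > (0 : ℝ), ∀ p ∈ S, ∀ z ∈ ball (r : ℂ) r, p + z • n ∈ D := by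
  suffices h : ∃ r > (0 : ℝ), ∀ p ∈ S ∩ S, ∀ z ∈ ball (r : ℂ) r, p + z • n ∈ D by
    simpa using h
  refine hS.induction_on (p := fun T => ∃ r > (0 : ℝ), ∀ p ∈ T ∩ S, ∀ z ∈ ball (r : ℂ) r,
    p + z • n ∈ D) ⟨1, one_pos, by simp⟩ ?_ ?_ ?_
  · rintro T T' hT ⟨r, hr, h⟩
    exact ⟨r, hr, fun p hp => h p ⟨hT hp.1, hp.2⟩⟩
  · rintro T T' ⟨r, hr, h⟩ ⟨r', hr', h'⟩
    refine ⟨min r r', lt_min hr hr', ?_⟩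
    rintro p ⟨hp | hp, hpS⟩ z hz
    · exact h p ⟨hp, hpS⟩ z (ball_ofReal_subset_ball_ofReal (min_le_left _ _) hz)
    · exact h' p ⟨hp, hpS⟩ z (ball_ofReal_subset_ball_ofReal (min_le_right _ _) hz)
  · intro p hp
    obtain ⟨ε, hε, r, hr, h⟩ := hs.exists_tangent_disc_near hD f hpos hfn (hSD hp) (hSc p hp)
    exact ⟨ball p ε, mem_nhdsWithin_of_mem_nhds (ball_mem_nhds p hε), r, hr,
      fun q hq => h q (hSD hq.2) (hSc q hq.2) hq.1⟩

/-- A holomorphic function on the disc whose real part is minimal at the centre is constant. -/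
theorem eq_of_re_ge {g : ℂ → ℂ} (hg : DifferentiableOn ℂ g (ball 0 1))
    (hre : ∀ ζ ∈ ball (0 : ℂ) 1, (g 0).re ≤ (g ζ).re) {ζ : ℂ} (hζ : ζ ∈ ball (0 : ℂ) 1) :
    g ζ = g 0 := by
  have h0 : (0 : ℂ) ∈ ball (0 : ℂ) 1 := by simp
  rcases (hg.analyticOnNhd isOpen_ball).is_constant_or_isOpen
    (convex_ball (0 : ℂ) 1).isPreconnected with ⟨w, hw⟩ | h
  · rw [hw ζ hζ, hw 0 h0]
  · exfalso
    obtain ⟨ε, hε, hsub⟩ := Metric.isOpen_iff.1 (h _ subset_rfl isOpen_ball) (g 0)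
      (mem_image_of_mem g h0)
    -- An open image would contain a point to the left of `g 0`.
    obtain ⟨ξ, hξ, hgξ⟩ := hsub (a := g 0 - ((ε / 2 : ℝ) : ℂ)) (by
      rw [mem_ball, dist_eq_norm, sub_sub_cancel_left, norm_neg, Complex.norm_real,
        Real.norm_eq_abs, abs_of_pos (by positivity)]
      linarith)
    have := hre ξ hξ
    rw [hgξ, Complex.sub_re, Complex.ofReal_re] at this
    linarith

/-- A boundary point, a complex supporting functional and a complex direction, such that the
points of the boundary on the supporting hyperplane in this direction contain the closed unit
disc but no real point beyond `1`. -/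
theorem exists_face_disc (hdim : Module.finrank ℂ E = 2) (hD : IsOpen D) (hc : Convex ℝ D)
    (hlines : ¬ ContainsComplexLine D) (hdisc : ContainsAnalyticDisc (frontier D)) :
    ∃ (f : E →L[ℂ] ℂ) (o e n : E), f n = 1 ∧ f e = 0 ∧ (∀ z ∈ D, (f o).re < (f z).re) ∧
      (∀ ζ ∈ closedBall (0 : ℂ) 1, o + ζ • e ∈ frontier D) ∧
      ∀ η : ℝ, 0 < η → o + ((1 + η : ℝ) : ℂ) • e ∉ closure D := by
  obtain ⟨φ, hφ, ζ₁, hζ₁, hne⟩ := hdisc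
  have h0 : (0 : ℂ) ∈ ball (0 : ℂ) 1 := by simp
  set o := φ 0 with ho
  have hoD : o ∈ frontier D := hφ.2 h0
  rw [hD.frontier_eq] at hoD
  obtain ⟨f₀, hf₀⟩ := RCLike.geometric_hahn_banach_open_point (𝕜 := ℂ) hc hD hoD.2
  obtain ⟨a, ha⟩ : D.Nonempty := closure_nonempty_iff.1 ⟨o, hoD.1⟩
  set f := -f₀ with hf
  have hpos : ∀ z ∈ D, (f o).re < (f z).re := by
    intro z hz
    have : (f₀ z).re < (f₀ o).re := hf₀ z hz
    simpa [hf] using this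
  have hcl : ∀ z ∈ closure D, (f o).re ≤ (f z).re := fun z hz =>
    closure_minimal (t := {z | (f o).re ≤ (f z).re}) (fun x hx => (hpos x hx).le)
      (isClosed_le continuous_const (Complex.continuous_re.comp f.continuous)) hz
  have hfne : f ≠ 0 := by
    intro h
    have := hpos a ha
    simp [h] at this
  obtain ⟨v, hv⟩ : ∃ v, f v ≠ 0 := by
    by_contra! h
    exact hfne (ContinuousLinearMap.ext h)
  have hfφ : ∀ ζ ∈ ball (0 : ℂ) 1, f (φ ζ) = f o := fun ζ hζ =>
    eq_of_re_ge (g := fun ζ => f (φ ζ)) (f.differentiable.comp_differentiableOn hφ.1)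
      (fun ξ hξ => hcl _ (frontier_subset_closure (hφ.2 hξ))) hζ
  set e₀ := φ ζ₁ - o with he₀
  have he₀ne : e₀ ≠ 0 := sub_ne_zero.2 hne
  have hfe₀ : f e₀ = 0 := by rw [he₀, map_sub, hfφ ζ₁ hζ₁, sub_self]
  have : FiniteDimensional ℂ E := Module.finite_of_finrank_pos (by omega)
  -- Dimension two forces the disc into the single complex line `o + ℂ e₀`.
  have hker : Module.finrank ℂ (LinearMap.ker f.toLinearMap) = 1 := by
    have h1 := LinearMap.finrank_range_add_finrank_ker f.toLinearMap
    have h2 : LinearMap.range f.toLinearMap = ⊤ :=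
      LinearMap.range_eq_top.2 (LinearMap.surjective fun h =>
        hfne (ContinuousLinearMap.ext fun x => DFunLike.congr_fun h x))
    rw [h2, finrank_top, Module.finrank_self] at h1
    omega
  have hspan : ∀ u : E, f u = 0 → ∃ s : ℂ, s • e₀ = u := by
    intro u hu
    obtain ⟨s, hs⟩ := exists_smul_eq_of_finrank_eq_one hker
      (x := ⟨e₀, LinearMap.mem_ker.2 hfe₀⟩) (fun h => he₀ne (congrArg Subtype.val h))
      ⟨u, LinearMap.mem_ker.2 hu⟩
    exact ⟨s, congrArg Subtype.val hs⟩
  obtain ⟨g, hg⟩ := SeparatingDual.exists_eq_one (R := ℂ) he₀ne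
  set ψ : ℂ → ℂ := fun ζ => g (φ ζ - o) with hψ
  have hφψ : ∀ ζ ∈ ball (0 : ℂ) 1, o + ψ ζ • e₀ = φ ζ := by
    intro ζ hζ
    obtain ⟨s, hs⟩ := hspan (φ ζ - o) (by rw [map_sub, hfφ ζ hζ, sub_self])
    simp only [hψ]
    rw [← hs, map_smul, hg, smul_eq_mul, mul_one, hs, add_sub_cancel]
  set F : Set ℂ := {ζ | o + ζ • e₀ ∈ closure D} with hF
  have hFclosed : IsClosed F := isClosed_closure.preimage (by fun_prop)
  have hFconv : Convex ℝ F := by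
    intro x hx y hy s t hs ht hst
    have := hc.closure hx hy hs ht hst
    rw [hF, mem_ofPred_eq]
    convert this using 1
    rw [smul_add, smul_add, add_add_add_comm, ← add_smul, hst, one_smul, add_smul, smul_assoc,
      smul_assoc]
  -- Open mapping theorem for the coordinate `ψ` of `φ` along `e₀`.
  have hF0 : (0 : ℂ) ∈ interior F := by
    have hψdiff : DifferentiableOn ℂ ψ (ball 0 1) :=
      g.differentiable.comp_differentiableOn (hφ.1.sub_const o)
    have hψ0 : ψ 0 = 0 := by simp [hψ, ← ho]
    rcases (hψdiff.analyticOnNhd isOpen_ball).is_constant_or_isOpen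
      (convex_ball (0 : ℂ) 1).isPreconnected with ⟨w, hw⟩ | h
    · exfalso
      have h1 : ψ ζ₁ = 1 := hg
      rw [hw ζ₁ hζ₁, ← hw 0 h0, hψ0] at h1
      exact zero_ne_one h1
    · refine mem_interior.2 ⟨ψ '' ball 0 1, ?_, h _ subset_rfl isOpen_ball, 0, h0, hψ0⟩
      rintro _ ⟨ζ, hζ, rfl⟩
      rw [hF, mem_ofPred_eq, hφψ ζ hζ]
      exact frontier_subset_closure (hφ.2 hζ)
  have hFne : (closure Fᶜ).Nonempty := by
    rw [closure_nonempty_iff, nonempty_compl]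
    intro huniv
    -- Midpoints of the interior point `a` with a line in `closure D` form a line in `D`; halving
    -- explains `2 * ζ` below.
    refine hlines ⟨(1 / 2 : ℝ) • a + (1 / 2 : ℝ) • o, e₀, he₀ne, fun ζ => ?_⟩
    have hmem : 2 * ζ ∈ F := huniv ▸ mem_univ _
    have := hc.combo_interior_closure_mem_interior (a := (1 / 2 : ℝ)) (b := (1 / 2 : ℝ))
      (by rwa [hD.interior_eq]) hmem (by norm_num) (by norm_num) (by norm_num)
    rw [hD.interior_eq] at this
    convert this using 1
    rw [smul_add, add_assoc, ← smul_assoc]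
    congr 3
    simp
  -- A boundary point of `F` nearest to `0`: the disc of radius `‖b‖` lies in `F`, and taking `b •
  -- e₀` as direction places `b` at `1`.
  obtain ⟨b, hb, hbdist⟩ := isClosed_closure.exists_infDist_eq_dist hFne (0 : ℂ)
  rw [closure_compl] at hb hbdist
  have hb0 : b ≠ 0 := fun h => hb (h ▸ hF0)
  have hballF : closedBall (0 : ℂ) ‖b‖ ⊆ F := by
    have h1 : ball (0 : ℂ) ‖b‖ ⊆ F := by
      have := ball_infDist_compl_subset (s := interior F) (x := (0 : ℂ))
      rw [hbdist, dist_zero_left] at this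
      exact this.trans interior_subset
    rw [← closure_ball (0 : ℂ) (norm_ne_zero_iff.2 hb0)]
    exact closure_minimal h1 hFclosed
  refine ⟨f, o, b • e₀, (f v)⁻¹ • v, ?_, ?_, hpos, ?_, ?_⟩
  · rw [map_smul, smul_eq_mul, inv_mul_cancel₀ hv]
  · rw [map_smul, hfe₀, smul_zero]
  · intro ζ hζ
    rw [hD.frontier_eq]
    refine ⟨?_, fun hmem => ?_⟩
    · rw [smul_smul]
      refine hballF (a := ζ * b) ?_
      rw [mem_closedBall_zero_iff] at hζ ⊢
      rw [norm_mul]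
      exact mul_le_of_le_one_left (norm_nonneg b) hζ
    · have := hpos _ hmem
      simp [hfe₀] at this
  · intro η hη hmem
    rw [smul_smul] at hmem
    have hF' : ((1 + η : ℝ) : ℂ) * b ∈ F := hmem
    have h1 : 0 < 1 + η := by linarith
    -- If `(1 + η) b` were in `F`, then `b`, strictly between it and the interior point `0`, would
    -- be interior.
    have := hFconv.combo_interior_closure_mem_interior hF0 (subset_closure hF')
      (a := η / (1 + η)) (b := 1 / (1 + η)) (by positivity) (by positivity) (by field_simp; ring)
    rw [smul_zero, zero_add, ← Complex.coe_smul, smul_eq_mul, ← mul_assoc, ← Complex.ofReal_mul,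
      one_div, inv_mul_cancel₀ h1.ne', Complex.ofReal_one, one_mul] at this
    exact hb this

/-- The closed face disc is compact, so its tangent discs share a radius and together fill out the
required bidisc. -/
theorem not_isGromovHyperbolic_kobayashiDist (hdim : Module.finrank ℂ E = 2) (hD : IsOpen D)
    (hc : Convex ℝ D) (hlines : ¬ ContainsComplexLine D) (hs : HasC11Boundary D)
    (hdisc : ContainsAnalyticDisc (frontier D)) :
    ¬ IsGromovHyperbolic (kobayashiDist D) := by
  obtain ⟨f, o, e, n, hfn, hfe, hpos, hin, hout⟩ := exists_face_disc hdim hD hc hlines hdisc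
  obtain ⟨r, hr, hsub⟩ := hs.exists_tangent_disc hD f hpos hfn
    (S := (fun ζ : ℂ => o + ζ • e) '' closedBall 0 1)
    ((isCompact_closedBall 0 1).image (by fun_prop))
    (by rintro _ ⟨ζ, hζ, rfl⟩; exact hin ζ hζ) (by rintro _ ⟨ζ, hζ, rfl⟩; simp [hfe])
  refine not_isGromovHyperbolic_of_tangent_bidisc hD hc f hfn hfe hpos hr (fun z₁ hz₁ z₂ hz₂ => ?_)
    hout
  rw [add_right_comm]
  exact hsub _ ⟨z₂, ball_subset_closedBall hz₂, rfl⟩ z₁ hz₁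

end Face

end KobGromov

theorem theorem1 (D : Set (EuclideanSpace ℂ (Fin 2)))
    (hD_open : IsOpen D) (hD_convex : Convex ℝ D)
    (hD_lines : ¬ KobGromov.ContainsComplexLine D)
    (hD_smooth : KobGromov.HasC11Boundary D)
    (hD_disc : KobGromov.ContainsAnalyticDisc (frontier D)) :
    ¬ KobGromov.IsGromovHyperbolic (KobGromov.kobayashiDist D) := by
  exact KobGromov.not_isGromovHyperbolic_kobayashiDist (by simp) hD_open hD_convex hD_lines
    hD_smooth hD_disc
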